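/- Let $q$ be a prime power, let $k\ge 1$ and $v\ge 2k$ be integers, and let $\mathbb{F}_q^v$ be a $v$-dimensional vector space over the finite field $\mathbb{F}_q$ with $q$ elements. The $q$-Kneser graph $qK(v,k)$ has as vertices the $k$-dimensional subspaces of $\mathbb{F}_q^v$, two vertices being adjacent when they intersect trivially. For an integer $n$ and a nonnegative integer $i$ write $$\binom{n}{i}_q=\prod_{j=0}^{i-1}\frac{q^{n-j}-1}{q^{i-j}-1},\qquad \binom{n}{0}_q=1 .$$ Then the numbers $$\lambda_j=(-1)^j\,q^{\binom{k}{2}+\binom{k-j+1}{2}}\binom{v-k-j}{v-2k}_q,\qquad j=0,1,\ldots,k,$$ are pairwise distinct, and they are exactly the eigenvalues of (the adjacency matrix of) $qK(v,k)$. Moreover, the multiplicity of $\lambda_j$ is $1$ if $j=0$, and $\binom{v}{j}_q-\binom{v}{j-1}_q$ if $1\le j\le k$. -/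

import Mathlib

/-- The Gaussian coefficient `[n choose i]_q = ∏_{j=0}^{i-1} (q^(n-j) - 1) / (q^(i-j) - 1)`, for an
integer `n` and a nonnegative integer `i`; the empty product gives the value `1` at `i = 0`. -/
noncomputable def gaussianCoeff (q : ℕ) (n : ℤ) (i : ℕ) : ℝ :=
  ∏ j ∈ Finset.range i,
    ((q : ℝ) ^ (n - (j : ℤ)) - 1) / ((q : ℝ) ^ ((i : ℤ) - (j : ℤ)) - 1)

/-- The type of `k`-dimensional subspaces of the vector space `V` over the field `F`. -/
abbrev KSubspace (F V : Type*) [Field F] [AddCommGroup V] [Module F V] (k : ℕ) :=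
  {W : Submodule F V // Module.finrank F W = k}

/-- A finite-dimensional space over a finite field has finitely many `k`-dimensional subspaces. -/
instance KSubspace.instFinite (F V : Type*) [Field F] [Finite F] [AddCommGroup V] [Module F V]
    [FiniteDimensional F V] (k : ℕ) : Finite (KSubspace F V k) := by
  haveI : Finite V := Module.finite_of_finite F
  haveI : Finite (Submodule F V) :=
    Finite.of_injective (fun W : Submodule F V => (W : Set V)) SetLike.coe_injective
  infer_instance

/-- The `q`-Kneser graph: vertices are the `k`-dimensional subspaces of `V`, and two (distinct)
vertices are adjacent when they intersect trivially. For `k ≥ 1` distinctness is automatic. -/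
def qKneserGraph (F V : Type*) [Field F] [AddCommGroup V] [Module F V] (k : ℕ) :
    SimpleGraph (KSubspace F V k) where
  Adj U W := U ≠ W ∧ U.1 ⊓ W.1 = ⊥
  symm := ⟨fun _ _ h => ⟨h.1.symm, by rw [inf_comm]; exact h.2⟩⟩
  loopless := ⟨fun _ h => h.1 rfl⟩

/-- `λ_j = (-1)^j q^(C(k,2) + C(k-j+1,2)) [v-k-j choose v-2k]_q`, used for `j ≤ k` and
`2k ≤ v`, where no natural-number subtraction truncates. -/
noncomputable def qKneserEigenvalue (q v k j : ℕ) : ℝ :=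
  (-1) ^ j * (q : ℝ) ^ (k.choose 2 + (k - j + 1).choose 2) *
    gaussianCoeff q ((v : ℤ) - (k : ℤ) - (j : ℤ)) (v - 2 * k)

/-!
The adjacency operator `A` of the `q`-Kneser graph is triangular for a filtration of the space of
functions on the `k`-dimensional subspaces. For `i ≤ k` let `W i` (`inclusionSum i k`) send a
function `f` on the `i`-dimensional subspaces to the function `U ↦ ∑ f T`, summed over `T ≤ U`.

* The ranges of the `W i` increase with `i` (`range_inclusionSum_le_succ`), and `W k` is the
  identity.
* `A (W i f)` at `U` is the sum of `f T` over the `T` that meet `U` trivially, times the number of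
  `k`-dimensional subspaces above `T` that meet `U` trivially (`card_le_disjoint`). Möbius inversion
  (`sum_mobius_common_subspaces`) writes the indicator of `T ⊓ U = ⊥` as the sum over `j ≤ i` of
  `(-1)^j q^(j choose 2)` times the number of `j`-dimensional subspaces of `T ⊓ U`. Hence
  `A (W i f)` is a combination of functions in the ranges of the `W j`, in which the term `j = i` is
  the scalar `λ_i` times `W i f` (`kneserOp_inclusionSum`). So `A` acts as `λ_i` on the range of
  `W i` modulo that of `W (i - 1)`.
* Each `W i` is injective (`inclusionSum_injective`), so its range has dimension `[v choose i]_q`.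
  This reduces to consecutive dimensions below the middle, where counting common upper and lower
  covers gives `‖U f‖² = ‖D f‖² + c ‖f‖²` with `c > 0` (`inclusionSum_succ_injective`).

As `|λ_j|` decreases strictly with `j` (`abs_qKneserEigenvalue_lt`), the `λ_j` are distinct, and
linear algebra (`finrank_eigenspace_add_finrank`) shows that the eigenspace of `λ_i` is a complement
of the range of `W (i - 1)` in the range of `W i`. The counts come from tuples of vectors that are
linearly independent modulo a subspace (`card_disjoint`).
-/

/-! ### Gaussian coefficients -/

/-- For a natural number `n`, the Gaussian coefficient is the quotient of the number of linearly
independent `i`-tuples in an `n`-dimensional space by their number in an `i`-dimensional one. -/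
lemma gaussianCoeff_natCast {q : ℕ} (hq : 1 < q) (n i : ℕ) :
    gaussianCoeff q (n : ℤ) i =
      ∏ j ∈ Finset.range i, ((q : ℝ) ^ n - (q : ℝ) ^ j) / ((q : ℝ) ^ i - (q : ℝ) ^ j) := by
  have h0 : (q : ℝ) ≠ 0 := by positivity
  unfold gaussianCoeff
  refine Finset.prod_congr rfl fun j _ => ?_
  rw [← mul_div_mul_right _ _ (pow_ne_zero j h0), sub_mul, sub_mul, zpow_sub₀ h0, zpow_sub₀ h0]
  simp [h0]

lemma prod_pow_sub_pow_pos {q : ℕ} (hq : 1 < q) {m i : ℕ} (h : m ≤ i) :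
    0 < ∏ j ∈ Finset.range m, ((q : ℝ) ^ i - (q : ℝ) ^ j) := by
  refine Finset.prod_pos fun j hj => sub_pos.2 ?_
  exact pow_lt_pow_right₀ (by exact_mod_cast hq) (by have := Finset.mem_range.1 hj; omega)

lemma gaussianCoeff_mul_prod {q : ℕ} (hq : 1 < q) (n i : ℕ) :
    gaussianCoeff q (n : ℤ) i * ∏ j ∈ Finset.range i, ((q : ℝ) ^ i - (q : ℝ) ^ j) =
      ∏ j ∈ Finset.range i, ((q : ℝ) ^ n - (q : ℝ) ^ j) := by
  rw [gaussianCoeff_natCast hq, Finset.prod_div_distrib,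
    div_mul_cancel₀ _ (prod_pow_sub_pow_pos hq le_rfl).ne']

lemma gaussianCoeff_pos {q : ℕ} (hq : 1 < q) {n i : ℕ} (h : i ≤ n) :
    0 < gaussianCoeff q (n : ℤ) i := by
  rw [gaussianCoeff_natCast hq, Finset.prod_div_distrib]
  exact div_pos (prod_pow_sub_pow_pos hq h) (prod_pow_sub_pow_pos hq le_rfl)

lemma prod_pow_succ_sub_pow (x y : ℝ) (i : ℕ) :
    ∏ j ∈ Finset.range (i + 1), (x * y - x ^ j) =
      (x * y - 1) * (x ^ i * ∏ j ∈ Finset.range i, (y - x ^ j)) := by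
  rw [Finset.prod_range_succ', mul_comm, pow_zero]
  congr 1
  · have h : x ^ i = ∏ _j ∈ Finset.range i, x := by simp
    rw [h, ← Finset.prod_mul_distrib]
    exact Finset.prod_congr rfl fun j _ => by ring

/-- Pascal's rule for Gaussian coefficients. -/
lemma gaussianCoeff_succ_succ {q : ℕ} (hq : 1 < q) (n i : ℕ) :
    gaussianCoeff q ((n + 1 : ℕ) : ℤ) (i + 1) =
      (q : ℝ) ^ (i + 1) * gaussianCoeff q (n : ℤ) (i + 1) + gaussianCoeff q (n : ℤ) i := by
  have h1 := gaussianCoeff_mul_prod hq (n + 1) (i + 1)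
  have h2 := gaussianCoeff_mul_prod hq n (i + 1)
  have h3 := gaussianCoeff_mul_prod hq n i
  have hp := prod_pow_sub_pow_pos hq (le_refl (i + 1))
  refine mul_right_cancel₀ hp.ne' ?_
  rw [h1, add_mul, mul_assoc, h2]
  simp only [pow_succ' (q : ℝ)]
  rw [prod_pow_succ_sub_pow, prod_pow_succ_sub_pow, Finset.prod_range_succ, ← h3]
  ring

lemma gaussianCoeff_zero_right (q : ℕ) (n : ℤ) : gaussianCoeff q n 0 = 1 := by
  simp [gaussianCoeff]

lemma gaussianCoeff_zero_succ {q : ℕ} (hq : 1 < q) (i : ℕ) :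
    gaussianCoeff q ((0 : ℕ) : ℤ) (i + 1) = 0 := by
  rw [gaussianCoeff_natCast hq]
  exact Finset.prod_eq_zero (Finset.mem_range.2 i.succ_pos) (by simp)

lemma gaussianCoeff_eq_zero {q : ℕ} (hq : 1 < q) {n i : ℕ} (h : n < i) :
    gaussianCoeff q (n : ℤ) i = 0 := by
  rw [gaussianCoeff_natCast hq]
  exact Finset.prod_eq_zero (Finset.mem_range.2 h) (by simp)

lemma prod_pow_sub_pow_mul (x : ℝ) (a b : ℕ) :
    (∏ j ∈ Finset.range a, (x ^ (a + b) - x ^ j)) * ∏ l ∈ Finset.range b, (x ^ (l + 1) - 1) =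
      (∏ j ∈ Finset.range a, x ^ j) * ∏ l ∈ Finset.range (a + b), (x ^ (l + 1) - 1) := by
  induction a with
  | zero => simp
  | succ a ih =>
    have : a + 1 + b = (a + b) + 1 := by ring
    rw [this, pow_succ', prod_pow_succ_sub_pow, Finset.prod_range_succ (n := a + b),
      Finset.prod_range_succ (fun j => x ^ j)]
    linear_combination (x * x ^ (a + b) - 1) * x ^ a * ih

/-- The expression of a Gaussian coefficient by `q`-factorials, cleared of denominators and of
powers of `q - 1`. -/
lemma gaussianCoeff_add_mul {q : ℕ} (hq : 1 < q) (a b : ℕ) :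
    gaussianCoeff q ((a + b : ℕ) : ℤ) a *
      ((∏ l ∈ Finset.range a, ((q : ℝ) ^ (l + 1) - 1)) *
        ∏ l ∈ Finset.range b, ((q : ℝ) ^ (l + 1) - 1)) =
      ∏ l ∈ Finset.range (a + b), ((q : ℝ) ^ (l + 1) - 1) := by
  have h1 := gaussianCoeff_mul_prod hq (a + b) a
  have h2 := prod_pow_sub_pow_mul (q : ℝ) a b
  have h3 := prod_pow_sub_pow_mul (q : ℝ) a 0
  simp only [add_zero, Finset.range_zero, Finset.prod_empty, mul_one] at h3
  have hp : (∏ j ∈ Finset.range a, (q : ℝ) ^ j) ≠ 0 :=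
    Finset.prod_ne_zero_iff.2 fun j _ => by positivity
  refine mul_left_cancel₀ hp ?_
  rw [← h2, ← h1, h3]
  ring

lemma gaussianCoeff_symm {q : ℕ} (hq : 1 < q) (a b : ℕ) :
    gaussianCoeff q ((a + b : ℕ) : ℤ) a = gaussianCoeff q ((a + b : ℕ) : ℤ) b := by
  have h1 := gaussianCoeff_add_mul hq a b
  have h2 := gaussianCoeff_add_mul hq b a
  rw [add_comm b a, ← h1, mul_comm (∏ l ∈ Finset.range b, _)] at h2
  have hp : ∀ n, (∏ l ∈ Finset.range n, ((q : ℝ) ^ (l + 1) - 1)) ≠ 0 := fun n =>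
    Finset.prod_ne_zero_iff.2 fun l _ =>
      (sub_pos.2 (one_lt_pow₀ (by exact_mod_cast hq) l.succ_ne_zero)).ne'
  exact (mul_right_cancel₀ (mul_ne_zero (hp a) (hp b)) h2).symm

lemma gaussianCoeff_one {q : ℕ} (n : ℕ) :
    gaussianCoeff q (n : ℤ) 1 = ((q : ℝ) ^ n - 1) / ((q : ℝ) - 1) := by
  simp [gaussianCoeff]

lemma gaussianCoeff_one_lt {q : ℕ} (hq : 1 < q) {m n : ℕ} (h : m < n) :
    gaussianCoeff q (m : ℤ) 1 < gaussianCoeff q (n : ℤ) 1 := by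
  have hq' : (1 : ℝ) < q := by exact_mod_cast hq
  rw [gaussianCoeff_one, gaussianCoeff_one]
  have : 0 < (q : ℝ) - 1 := by linarith
  have := pow_lt_pow_right₀ hq' h
  gcongr

lemma gaussianCoeff_mono {q : ℕ} (hq : 1 < q) {m n : ℕ} (h : m ≤ n) {i : ℕ} (hi : i ≤ m) :
    gaussianCoeff q (m : ℤ) i ≤ gaussianCoeff q (n : ℤ) i := by
  have hq' : (1 : ℝ) < q := by exact_mod_cast hq
  rw [gaussianCoeff_natCast hq, gaussianCoeff_natCast hq]
  refine Finset.prod_le_prod (fun j hj => ?_) fun j hj => ?_ <;> have hj := Finset.mem_range.1 hj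
  · exact div_nonneg (sub_nonneg.2 (pow_le_pow_right₀ hq'.le (by omega)))
      (sub_nonneg.2 (pow_le_pow_right₀ hq'.le (by omega)))
  · have h1 := pow_lt_pow_right₀ hq' hj
    have h2 := pow_le_pow_right₀ hq'.le h
    have : 0 < (q : ℝ) ^ i - (q : ℝ) ^ j := by linarith
    gcongr

/-- Gaussian coefficients increase strictly up to the middle; this makes every multiplicity
positive. -/
lemma gaussianCoeff_lt_succ {q : ℕ} (hq : 1 < q) {n i : ℕ} (h : 2 * i + 1 < n) :
    gaussianCoeff q (n : ℤ) i < gaussianCoeff q (n : ℤ) (i + 1) := by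
  have hq' : (1 : ℝ) < q := by exact_mod_cast hq
  have h1 := gaussianCoeff_mul_prod hq n i
  have h2 := gaussianCoeff_mul_prod hq n (i + 1)
  rw [pow_succ', prod_pow_succ_sub_pow, Finset.prod_range_succ, ← h1] at h2
  have hp := prod_pow_sub_pow_pos hq (le_refl i)
  have hg := gaussianCoeff_pos hq (show i ≤ n by omega)
  have h3 : gaussianCoeff q (n : ℤ) (i + 1) * (((q : ℝ) * q ^ i - 1) * q ^ i) =
      gaussianCoeff q (n : ℤ) i * ((q : ℝ) ^ n - q ^ i) :=
    mul_right_cancel₀ hp.ne' (by linear_combination h2)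
  have hx : (1 : ℝ) ≤ (q : ℝ) ^ i := one_le_pow₀ hq'.le
  have h4 : (q : ℝ) * q ^ i * q ^ i < (q : ℝ) ^ n := by
    rw [← pow_succ', ← pow_add]
    exact pow_lt_pow_right₀ hq' (by omega)
  have h5 : 0 < ((q : ℝ) * q ^ i - 1) * q ^ i := by
    have : (1 : ℝ) < q * q ^ i := by nlinarith
    have : 0 < (q : ℝ) * q ^ i - 1 := by linarith
    positivity
  refine lt_of_mul_lt_mul_right ?_ h5.le
  rw [h3]
  exact mul_lt_mul_of_pos_left (by linear_combination h4) hg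

/-- The Möbius function of the subspace lattice: the numbers `(-1)^j q^(j choose 2)` invert
the counting of subspaces. -/
lemma sum_mobius_gaussianCoeff {q : ℕ} (hq : 1 < q) (r i : ℕ) (h : r ≤ i) :
    ∑ j ∈ Finset.range (i + 1), (-1) ^ j * (q : ℝ) ^ j.choose 2 * gaussianCoeff q (r : ℤ) j =
      if r = 0 then 1 else 0 := by
  cases r with
  | zero =>
    rw [Finset.sum_range_succ', Finset.sum_eq_zero fun j _ => by
      rw [gaussianCoeff_zero_succ hq, mul_zero]]
    simp [gaussianCoeff_zero_right]
  | succ r =>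
    -- Pascal's rule turns the sum into a telescoping one.
    have key : ∀ n : ℕ, ∑ j ∈ Finset.range (n + 1), (-1) ^ j * (q : ℝ) ^ j.choose 2 *
        gaussianCoeff q ((r + 1 : ℕ) : ℤ) j =
          (-1) ^ n * (q : ℝ) ^ n.choose 2 * (q : ℝ) ^ n * gaussianCoeff q (r : ℤ) n := by
      intro n
      induction n with
      | zero => simp [gaussianCoeff_zero_right]
      | succ n ih =>
        rw [Finset.sum_range_succ, ih, gaussianCoeff_succ_succ hq, Nat.choose_succ_succ' n 1,
          Nat.choose_one_right]
        ring
    rw [key, gaussianCoeff_eq_zero hq (by omega)]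
    simp

/-! ### Counting subspaces -/

section Counting

open Module

variable {F V : Type*} [Field F] [Fintype F] [AddCommGroup V] [Module F V] [FiniteDimensional F V]

lemma card_linearIndependent_cast (m : ℕ) :
    (Nat.card {s : Fin m → V // LinearIndependent F s} : ℝ) =
      ∏ j ∈ Finset.range m, ((Fintype.card F : ℝ) ^ finrank F V - (Fintype.card F : ℝ) ^ j) := by
  have : Finite V := Module.finite_of_finite F
  rcases le_or_gt m (finrank F V) with h | h
  · rw [card_linearIndependent h, Nat.cast_prod, Finset.prod_range]
    refine Finset.prod_congr rfl fun j _ => ?_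
    rw [Nat.cast_sub (Nat.pow_le_pow_right Fintype.card_pos (by omega))]
    push_cast
    rfl
  · have : IsEmpty {s : Fin m → V // LinearIndependent F s} :=
      ⟨fun s => by simpa using s.2.fintype_card_le_finrank.trans_lt h⟩
    rw [Nat.card_of_isEmpty, Nat.cast_zero, Finset.prod_eq_zero (Finset.mem_range.2 h) (sub_self _)]

omit [Fintype F] [FiniteDimensional F V] in
/-- The quotient map by a subspace `U` and a projection onto `U` identify `V` with
`(V ⧸ U) × U`. -/
lemma exists_equiv_quotient_prod (U : Submodule F V) :
    ∃ e : V ≃ (V ⧸ U) × U, ∀ x, (e x).1 = U.mkQ x := by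
  obtain ⟨p, hp⟩ := U.subtype.exists_leftInverse_of_injective U.ker_subtype
  have hp' : ∀ u : U, p u = u := fun u => LinearMap.congr_fun hp u
  refine ⟨Equiv.ofBijective (fun x => (U.mkQ x, p x)) ⟨fun x y hxy => ?_, ?_⟩, fun x => rfl⟩
  · obtain ⟨h1, h2⟩ := Prod.mk.inj hxy
    have h3 : x - y ∈ U := (Submodule.Quotient.eq U).1 h1
    have h4 : p (x - y) = ⟨x - y, h3⟩ := hp' ⟨x - y, h3⟩
    rw [map_sub, h2, sub_self] at h4
    exact sub_eq_zero.1 (congrArg Subtype.val h4).symm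
  · rintro ⟨y, u⟩
    obtain ⟨x, rfl⟩ := U.mkQ_surjective y
    refine ⟨x + ((u - p x : U) : V), ?_⟩
    refine Prod.ext ?_ (by simp only [map_add, hp', add_sub_cancel])
    have h : U.mkQ ((u - p x : U) : V) = 0 := (Submodule.Quotient.mk_eq_zero U).2 (u - p x).2
    simp only [map_add, h, add_zero]

/-- The number of `m`-tuples of vectors that are linearly independent modulo `U`. -/
lemma card_linearIndependent_mkQ (U : Submodule F V) (m : ℕ) :
    (Nat.card {s : Fin m → V // LinearIndependent F (U.mkQ ∘ s)} : ℝ) =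
      (Fintype.card F : ℝ) ^ (finrank F U * m) *
        ∏ j ∈ Finset.range m,
          ((Fintype.card F : ℝ) ^ finrank F (V ⧸ U) - (Fintype.card F : ℝ) ^ j) := by
  have : Finite V := Module.finite_of_finite F
  have : Fintype U := Fintype.ofFinite U
  obtain ⟨e, he⟩ := exists_equiv_quotient_prod U
  have e1 : {s : Fin m → V // LinearIndependent F (U.mkQ ∘ s)} ≃
      {t : Fin m → V ⧸ U // LinearIndependent F t} × (Fin m → U) :=
    (((Equiv.refl (Fin m)).arrowCongr e).trans
      (Equiv.arrowProdEquivProdArrow (Fin m) (fun _ => V ⧸ U) (fun _ => U))).subtypeEquiv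
        (q := fun t => LinearIndependent F t.1) (fun s => by
          have : U.mkQ ∘ s = fun i => (e (s i)).1 := funext fun i => (he (s i)).symm
          rw [this]; rfl) |>.trans
      (Equiv.prodSubtypeFstEquivSubtypeProd (p := fun t : Fin m → V ⧸ U => LinearIndependent F t))
  rw [Nat.card_congr e1, Nat.card_prod, Nat.cast_mul, card_linearIndependent_cast, mul_comm]
  congr 1
  rw [Nat.card_eq_fintype_card, Fintype.card_fun, Fintype.card_fin,
    Module.card_eq_pow_finrank (K := F), ← pow_mul, Nat.cast_pow]

omit [Fintype F] in
/-- A tuple independent modulo `U` is the same as a basis of a subspace that meets `U`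
trivially. -/
lemma card_linearIndependent_mkQ_eq_card_sigma (U : Submodule F V) (m : ℕ) :
    Nat.card {s : Fin m → V // LinearIndependent F (U.mkQ ∘ s)} =
      Nat.card (Σ W : {W : Submodule F V // finrank F W = m ∧ Disjoint W U},
        {s : Fin m → W.1 // LinearIndependent F s}) := by
  have hspan : ∀ W : Submodule F V, finrank F W = m → ∀ s : Fin m → W, LinearIndependent F s →
      Submodule.span F (Set.range fun i => (s i : V)) = W := by
    intro W hW s hs
    have h : LinearIndependent F fun i => (s i : V) := hs.map' W.subtype W.ker_subtype
    refine Submodule.eq_of_le_of_finrank_eq (Submodule.span_le.2 ?_) ?_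
    · rintro _ ⟨i, rfl⟩
      exact (s i).2
    · rw [finrank_span_eq_card h, Fintype.card_fin, hW]
  symm
  refine Nat.card_congr (Equiv.ofBijective (fun x => ⟨fun i => (x.2.1 i : V), ?_⟩) ⟨?_, ?_⟩)
  · obtain ⟨⟨W, hW, hd⟩, s, hs⟩ := x
    refine LinearIndependent.map (hs.map' W.subtype W.ker_subtype) ?_
    rw [U.ker_mkQ]
    exact (hspan W hW s hs).symm ▸ hd
  · rintro ⟨⟨W, hW, hd⟩, s, hs⟩ ⟨⟨W', hW', hd'⟩, s', hs'⟩ h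
    have h' : (fun i => (s i : V)) = fun i => (s' i : V) := congrArg Subtype.val h
    have hWW : W = W' := by rw [← hspan W hW s hs, ← hspan W' hW' s' hs', h']
    subst hWW
    have : s = s' := funext fun i => Subtype.ext (congrFun h' i)
    subst this
    rfl
  · rintro ⟨s, hs⟩
    have hs' : LinearIndependent F s := LinearIndependent.of_comp _ hs
    refine ⟨⟨⟨Submodule.span F (Set.range s), ?_, ?_⟩,
      fun i => ⟨s i, Submodule.subset_span ⟨i, rfl⟩⟩, ?_⟩, rfl⟩
    · rw [finrank_span_eq_card hs', Fintype.card_fin]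
    · rw [← U.ker_mkQ]
      exact Submodule.range_ker_disjoint hs
    · exact LinearIndependent.of_comp (Submodule.subtype _) hs'

/-- The number of `m`-dimensional subspaces that meet `U` trivially. -/
lemma card_disjoint (U : Submodule F V) {r : ℕ} (hr : finrank F V = r + finrank F U) (m : ℕ) :
    (Nat.card {W : Submodule F V // finrank F W = m ∧ Disjoint W U} : ℝ) =
      (Fintype.card F : ℝ) ^ (finrank F U * m) * gaussianCoeff (Fintype.card F) (r : ℤ) m := by
  have : Finite V := Module.finite_of_finite F
  have : Finite (Submodule F V) :=
    Finite.of_injective (fun W : Submodule F V => (W : Set V)) SetLike.coe_injective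
  have : Fintype {W : Submodule F V // finrank F W = m ∧ Disjoint W U} := Fintype.ofFinite _
  have hq : 1 < Fintype.card F := Fintype.one_lt_card
  have h1 := card_linearIndependent_mkQ U m
  have hr' : finrank F (V ⧸ U) = r := by
    have := U.finrank_quotient_add_finrank
    omega
  rw [card_linearIndependent_mkQ_eq_card_sigma, Nat.card_sigma, Nat.cast_sum,
    Finset.sum_congr rfl fun W _ => by rw [card_linearIndependent_cast, W.2.1], Finset.sum_const,
    nsmul_eq_mul, Finset.card_univ, ← Nat.card_eq_fintype_card, hr',
    ← gaussianCoeff_mul_prod hq r, ← mul_assoc] at h1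
  exact mul_right_cancel₀ (prod_pow_sub_pow_pos hq le_rfl).ne' h1

omit [Fintype F] in
lemma finrank_comap_mkQ (T : Submodule F V) (W : Submodule F (V ⧸ T)) :
    finrank F (W.comap T.mkQ) = finrank F T + finrank F W := by
  have h := (T.mkQ.comp (W.comap T.mkQ).subtype).finrank_range_add_finrank_ker
  rw [LinearMap.range_comp, Submodule.range_subtype, Submodule.map_comap_eq, Submodule.range_mkQ,
    top_inf_eq, LinearMap.ker_comp, Submodule.ker_mkQ,
    (Submodule.comapSubtypeEquivOfLe (T.le_comap_mkQ W)).finrank_eq] at h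
  omega

omit [Fintype F] [FiniteDimensional F V] in
lemma finrank_map_mkQ {T U : Submodule F V} (h : Disjoint T U) :
    finrank F (U.map T.mkQ) = finrank F U := by
  have hi : Function.Injective (T.mkQ.comp U.subtype) := by
    rw [← LinearMap.ker_eq_bot, LinearMap.ker_comp, Submodule.ker_mkQ,
      ← Submodule.disjoint_iff_comap_eq_bot]
    exact h.symm
  rw [← LinearMap.finrank_range_of_inj hi, LinearMap.range_comp, Submodule.range_subtype]

omit [Fintype F] [FiniteDimensional F V] in
lemma disjoint_comap_mkQ_iff {T U : Submodule F V} (h : Disjoint T U) (W : Submodule F (V ⧸ T)) :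
    Disjoint (W.comap T.mkQ) U ↔ Disjoint W (U.map T.mkQ) := by
  simp only [Submodule.disjoint_def] at h ⊢
  constructor
  · rintro h' _ hw ⟨u, hu, rfl⟩
    rw [h' u hw hu, map_zero]
  · intro h' u hw hu
    refine h u ?_ hu
    rw [← Submodule.ker_mkQ T]
    exact h' _ hw ⟨u, hu, rfl⟩

/-- The number of subspaces of dimension `dim T + m` above `T` that meet `U` trivially. -/
lemma card_le_disjoint {T U : Submodule F V} (h : Disjoint T U) {r : ℕ}
    (hr : finrank F V = r + finrank F T + finrank F U) (m : ℕ) :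
    (Nat.card {W : Submodule F V // finrank F W = finrank F T + m ∧ T ≤ W ∧ Disjoint W U} : ℝ) =
      (Fintype.card F : ℝ) ^ (finrank F U * m) * gaussianCoeff (Fintype.card F) (r : ℤ) m := by
  have hr' : finrank F (V ⧸ T) = r + finrank F (U.map T.mkQ) := by
    have := T.finrank_quotient_add_finrank
    rw [finrank_map_mkQ h]
    omega
  rw [← finrank_map_mkQ h, ← card_disjoint _ hr']
  congr 1
  symm
  refine Nat.card_congr (Equiv.ofBijective (fun W => ⟨W.1.comap T.mkQ, ?_, ?_, ?_⟩) ⟨?_, ?_⟩)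
  · rw [finrank_comap_mkQ, W.2.1]
  · exact T.le_comap_mkQ W.1
  · exact (disjoint_comap_mkQ_iff h W.1).2 W.2.2
  · intro W W' hW
    exact Subtype.ext (Submodule.comap_injective_of_surjective T.mkQ_surjective
      (congrArg Subtype.val hW))
  · rintro ⟨W, h1, h2, h3⟩
    have hW : (W.map T.mkQ).comap T.mkQ = W := by rw [Submodule.comap_map_mkQ, sup_eq_right.2 h2]
    refine ⟨⟨W.map T.mkQ, ?_, ?_⟩, Subtype.ext hW⟩
    · have := finrank_comap_mkQ T (W.map T.mkQ)
      rw [hW] at this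
      omega
    · rw [← disjoint_comap_mkQ_iff h, hW]
      exact h3

/-- The number of subspaces of dimension `dim S + m` between `S` and `U`. -/
lemma card_le_le {S U : Submodule F V} (h : S ≤ U) {r : ℕ}
    (hr : finrank F U = r + finrank F S) (m : ℕ) :
    (Nat.card {W : Submodule F V // finrank F W = finrank F S + m ∧ S ≤ W ∧ W ≤ U} : ℝ) =
      gaussianCoeff (Fintype.card F) (r : ℤ) m := by
  have hS : finrank F (S.comap U.subtype) = finrank F S :=
    (Submodule.comapSubtypeEquivOfLe h).finrank_eq
  have key := card_le_disjoint (F := F) (V := U) (T := S.comap U.subtype) (U := ⊥) (r := r)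
    disjoint_bot_right (by rw [hS, finrank_bot, hr, add_zero]) m
  rw [finrank_bot, zero_mul, pow_zero, one_mul, hS] at key
  rw [← key]
  congr 1
  symm
  refine Nat.card_congr (Equiv.ofBijective (fun W => ⟨W.1.map U.subtype, ?_, ?_, ?_⟩) ⟨?_, ?_⟩)
  · rw [Submodule.finrank_map_subtype_eq, W.2.1]
  · have h' : S = (S.comap U.subtype).map U.subtype := by
      rw [Submodule.map_comap_subtype, inf_eq_right.2 h]
    exact h'.le.trans (Submodule.map_mono W.2.2.1)
  · exact Submodule.map_subtype_le _ _
  · intro W W' hW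
    exact Subtype.ext (Submodule.map_injective_of_injective U.subtype_injective
      (congrArg Subtype.val hW))
  · rintro ⟨W, h1, h2, h3⟩
    refine ⟨⟨W.comap U.subtype, ?_, Submodule.comap_mono h2, disjoint_bot_right⟩, Subtype.ext ?_⟩
    · rw [(Submodule.comapSubtypeEquivOfLe h3).finrank_eq, h1]
    · exact (Submodule.map_comap_subtype U W).trans (inf_eq_right.2 h3)

/-- The number of `m`-dimensional subspaces of `R`. -/
lemma card_le_subspace (R : Submodule F V) (m : ℕ) :
    (Nat.card {W : Submodule F V // finrank F W = m ∧ W ≤ R} : ℝ) =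
      gaussianCoeff (Fintype.card F) (finrank F R : ℤ) m := by
  simpa using card_le_le (F := F) (V := V) (bot_le : ⊥ ≤ R) (r := finrank F R) (by simp) m

lemma card_KSubspace (m : ℕ) :
    (Nat.card (KSubspace F V m) : ℝ) =
      gaussianCoeff (Fintype.card F) (finrank F V : ℤ) m := by
  simpa using card_le_subspace (⊤ : Submodule F V) m

end Counting

/-! ### Operators with a filtration -/

section Filtration

open Module

variable {E : Type*} [AddCommGroup E] [Module ℝ E] {A : End ℝ E} {L : ℕ → Submodule ℝ E}
  {c : ℕ → ℝ} {k : ℕ}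

/-- The hypothesis `hA` says that `A` acts as the scalar `c i` on the quotient `L (i + 1) / L i`.
It forces an eigenvector in `L n` down to `L m` if its eigenvalue avoids `c i` for `m ≤ i < n`. -/
lemma mem_of_filtration (hA : ∀ i ≤ k, ∀ x ∈ L (i + 1), A x - c i • x ∈ L i) {μ : ℝ} {x : E}
    (hx : A x = μ • x) {m n : ℕ} (hmn : m ≤ n) (hn : n ≤ k + 1)
    (hμ : ∀ i, m ≤ i → i < n → μ ≠ c i) (hxn : x ∈ L n) : x ∈ L m := by
  induction n, hmn using Nat.le_induction with
  | base => exact hxn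
  | succ n hmn ih =>
    refine ih (by omega) (fun i h1 h2 => hμ i h1 (by omega)) ?_
    have h := hA n (by omega) x hxn
    rw [hx, ← sub_smul] at h
    exact (Submodule.smul_mem_iff _ (sub_ne_zero.2 (hμ n hmn (by omega)))).1 h

lemma exists_eq_of_hasEigenvalue (h0 : L 0 = ⊥) (htop : L (k + 1) = ⊤)
    (hA : ∀ i ≤ k, ∀ x ∈ L (i + 1), A x - c i • x ∈ L i) {μ : ℝ} (hμ : A.HasEigenvalue μ) :
    ∃ i ≤ k, c i = μ := by
  by_contra! hne
  obtain ⟨x, hx⟩ := hμ.exists_hasEigenvector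
  have hx0 := mem_of_filtration hA hx.apply_eq_smul (Nat.zero_le (k + 1)) le_rfl
    (fun i _ hi => (hne i (by omega)).symm) (htop ▸ Submodule.mem_top)
  rw [h0, Submodule.mem_bot] at hx0
  exact hx.2 hx0

/-- If the scalars `c i` are distinct, the eigenspace of `c i` is a complement of `L i` in
`L (i + 1)`: on `L i` the operator `A - c i` is injective, hence surjective, which allows
correcting any vector of `L (i + 1)` by one of `L i` to an eigenvector. -/
lemma finrank_eigenspace_add_finrank [FiniteDimensional ℝ E] (h0 : L 0 = ⊥)
    (htop : L (k + 1) = ⊤) (hmono : ∀ i ≤ k, L i ≤ L (i + 1))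
    (hA : ∀ i ≤ k, ∀ x ∈ L (i + 1), A x - c i • x ∈ L i)
    (hc : Set.InjOn c {i | i ≤ k}) {i : ℕ} (hi : i ≤ k) :
    finrank ℝ (A.eigenspace (c i)) + finrank ℝ (L i) = finrank ℝ (L (i + 1)) := by
  have hinf : A.eigenspace (c i) ⊓ L i = ⊥ := by
    rw [eq_bot_iff, ← h0]
    rintro x ⟨hx, hxi⟩
    refine mem_of_filtration hA (End.mem_eigenspace_iff.1 hx) (Nat.zero_le i) (by omega)
      (fun j _ hj h => ?_) hxi
    exact hj.ne' (hc hi (show j ≤ k by omega) h)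
  have hsup : A.eigenspace (c i) ⊔ L i = L (i + 1) := by
    apply le_antisymm
    · refine sup_le (fun x hx => ?_) (hmono i hi)
      refine mem_of_filtration hA (End.mem_eigenspace_iff.1 hx) (by omega) le_rfl
        (fun j hj hj' h => ?_) (htop ▸ Submodule.mem_top)
      have := hc hi (show j ≤ k by omega) h
      omega
    · intro x hx
      have hinv : ∀ y ∈ L i, (A - c i • LinearMap.id : E →ₗ[ℝ] E) y ∈ L i := by
        intro y hy
        refine Submodule.sub_mem _ ?_ (Submodule.smul_mem _ _ hy)
        cases i with
        | zero =>
          rw [h0, Submodule.mem_bot] at hy ⊢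
          rw [hy, map_zero]
        | succ j =>
          have := hmono j (by omega) (hA j (by omega) y hy)
          simpa using Submodule.add_mem _ this (Submodule.smul_mem _ (c j) hy)
      have hinj : Function.Injective ((A - c i • LinearMap.id : E →ₗ[ℝ] E).restrict hinv) := by
        rw [← LinearMap.ker_eq_bot, eq_bot_iff]
        rintro ⟨y, hy⟩ h
        have h' : A y - c i • y = 0 := congrArg Subtype.val (LinearMap.mem_ker.1 h)
        have : y ∈ A.eigenspace (c i) ⊓ L i := ⟨End.mem_eigenspace_iff.2 (sub_eq_zero.1 h'), hy⟩
        rw [hinf, Submodule.mem_bot] at this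
        exact (Submodule.mem_bot ℝ).2 (Subtype.ext this)
      obtain ⟨⟨z, hz⟩, hzx⟩ := LinearMap.injective_iff_surjective.1 hinj ⟨_, hA i hi x hx⟩
      have hzx' : A z - c i • z = A x - c i • x := congrArg Subtype.val hzx
      refine Submodule.mem_sup.2 ⟨x - z, ?_, z, hz, sub_add_cancel x z⟩
      rw [End.mem_eigenspace_iff, map_sub, smul_sub]
      rw [sub_eq_sub_iff_add_eq_add, add_comm] at hzx'
      rw [sub_eq_sub_iff_add_eq_add, ← hzx', add_comm]
  have h := Submodule.finrank_sup_add_finrank_inf_eq (A.eigenspace (c i)) (L i)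
  rw [hinf, hsup, finrank_bot, add_zero] at h
  exact h.symm

end Filtration

/-! ### Inclusion operators -/

section Inclusion

open Module
open scoped Classical

lemma sum_subtype_ite {α : Type*} (Q P : α → Prop) [Fintype {a // Q a}]
    [DecidablePred P] (x : ℝ) :
    ∑ a : {a // Q a}, (if P a.1 then x else 0) = (Nat.card {a // Q a ∧ P a} : ℝ) * x := by
  rw [← Finset.sum_filter, Finset.sum_const, nsmul_eq_mul, ← Fintype.card_subtype,
    ← Nat.card_eq_fintype_card, Nat.card_congr (Equiv.subtypeSubtypeEquivSubtypeInter Q P)]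

lemma sum_sq_sum_ite {α β : Type*} [Fintype α] [Fintype β] (R : β → α → Prop)
    [∀ b a, Decidable (R b a)] (f : α → ℝ) :
    ∑ b, (∑ a, if R b a then f a else 0) ^ 2 =
      ∑ a, ∑ a', f a * f a' * ∑ b, if R b a ∧ R b a' then 1 else 0 := by
  simp_rw [Finset.mul_sum, sq, Finset.sum_mul_sum]
  rw [Finset.sum_comm]
  refine Finset.sum_congr rfl fun a _ => ?_
  rw [Finset.sum_comm]
  refine Finset.sum_congr rfl fun a' _ => Finset.sum_congr rfl fun b _ => ?_
  by_cases h : R b a <;> by_cases h' : R b a' <;> simp [h, h']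

variable {F V : Type*} [Field F] [AddCommGroup V] [Module F V]
  [∀ i, Fintype (KSubspace F V i)]

variable (F V) in
/-- The inclusion operator: it sends a function on the `i`-dimensional subspaces to the function
on the `j`-dimensional subspaces that sums it over all subspaces contained in the given one. -/
noncomputable def inclusionSum (i j : ℕ) : (KSubspace F V i → ℝ) →ₗ[ℝ] (KSubspace F V j → ℝ) where
  toFun f U := ∑ T : KSubspace F V i, if T.1 ≤ U.1 then f T else 0
  map_add' f g := by
    ext U
    simp only [Pi.add_apply, ← Finset.sum_add_distrib]
    exact Finset.sum_congr rfl fun T _ => by split_ifs <;> simp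
  map_smul' c f := by
    ext U
    simp [Finset.mul_sum]

lemma inclusionSum_apply {i j : ℕ} (f : KSubspace F V i → ℝ) (U : KSubspace F V j) :
    inclusionSum F V i j f U = ∑ T : KSubspace F V i, if T.1 ≤ U.1 then f T else 0 := rfl

omit [∀ i, Fintype (KSubspace F V i)] in
lemma KSubspace.eq_of_le [FiniteDimensional F V] {i : ℕ} {S T : KSubspace F V i}
    (h : S.1 ≤ T.1) : S = T :=
  Subtype.ext (Submodule.eq_of_le_of_finrank_eq h (S.2.trans T.2.symm))

lemma sum_le_same_dim [FiniteDimensional F V] {i : ℕ} (f : KSubspace F V i → ℝ)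
    (S : KSubspace F V i) :
    (∑ T : KSubspace F V i, if S.1 ≤ T.1 then f T else 0) = f S := by
  rw [Finset.sum_eq_single S, if_pos le_rfl]
  · exact fun T _ hT => if_neg fun h => hT (KSubspace.eq_of_le h).symm
  · exact fun h => absurd (Finset.mem_univ S) h

lemma inclusionSum_self [FiniteDimensional F V] (k : ℕ) :
    inclusionSum F V k k = LinearMap.id := by
  refine LinearMap.ext fun f => funext fun U => ?_
  rw [inclusionSum_apply, Finset.sum_eq_single U, if_pos le_rfl, LinearMap.id_apply]
  · exact fun T _ hT => if_neg fun h => hT (KSubspace.eq_of_le h)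
  · exact fun h => absurd (Finset.mem_univ U) h

variable [Fintype F] [FiniteDimensional F V]

lemma inclusionSum_comp_succ {j k : ℕ} (hjk : j ≤ k) :
    (inclusionSum F V (j + 1) k).comp (inclusionSum F V j (j + 1)) =
      gaussianCoeff (Fintype.card F) ((k - j : ℕ) : ℤ) 1 • inclusionSum F V j k := by
  refine LinearMap.ext fun f => funext fun U => ?_
  have h1 : inclusionSum F V (j + 1) k (inclusionSum F V j (j + 1) f) U =
      ∑ T : KSubspace F V (j + 1), ∑ S : KSubspace F V j,
        if S.1 ≤ T.1 ∧ T.1 ≤ U.1 then f S else 0 := by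
    simp only [inclusionSum_apply]
    refine Finset.sum_congr rfl fun T _ => ?_
    by_cases h : T.1 ≤ U.1 <;> simp [h]
  rw [LinearMap.comp_apply, h1, Finset.sum_comm, LinearMap.smul_apply, Pi.smul_apply,
    inclusionSum_apply, smul_eq_mul, Finset.mul_sum]
  refine Finset.sum_congr rfl fun S _ => ?_
  rw [sum_subtype_ite (fun W : Submodule F V => finrank F W = j + 1)
    (fun W => S.1 ≤ W ∧ W ≤ U.1)]
  by_cases h : S.1 ≤ U.1
  · rw [if_pos h, ← card_le_le h (r := k - j) (by rw [S.2, U.2]; omega) 1, S.2]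
  · have : IsEmpty {W : Submodule F V // finrank F W = j + 1 ∧ S.1 ≤ W ∧ W ≤ U.1} :=
      ⟨fun W => h (W.2.2.1.trans W.2.2.2)⟩
    rw [Nat.card_of_isEmpty, if_neg h]
    simp

omit [∀ i, Fintype (KSubspace F V i)] [Fintype F] in
/-- Two distinct `i`-dimensional subspaces have as many common upper covers as common lower
covers: one of each if their intersection has codimension one in both, and none otherwise. -/
lemma card_upper_eq_card_lower {i : ℕ} {T T' : KSubspace F V i} (h : T ≠ T') :
    Nat.card {W : Submodule F V // finrank F W = i + 1 ∧ T.1 ≤ W ∧ T'.1 ≤ W} =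
      Nat.card {S : Submodule F V // finrank F S + 1 = i ∧ S ≤ T.1 ∧ S ≤ T'.1} := by
  have hdim := Submodule.finrank_sup_add_finrank_inf_eq T.1 T'.1
  rw [T.2, T'.2] at hdim
  have hsup : i + 1 ≤ finrank F (T.1 ⊔ T'.1 : Submodule F V) := by
    have : T.1 < T.1 ⊔ T'.1 :=
      lt_of_le_of_ne le_sup_left fun h' => h (KSubspace.eq_of_le (sup_eq_left.1 h'.symm)).symm
    have := Submodule.finrank_lt_finrank_of_lt this
    rw [T.2] at this
    omega
  by_cases hi : finrank F (T.1 ⊔ T'.1 : Submodule F V) = i + 1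
  · have h1 : Unique {W : Submodule F V // finrank F W = i + 1 ∧ T.1 ≤ W ∧ T'.1 ≤ W} :=
      { default := ⟨T.1 ⊔ T'.1, hi, le_sup_left, le_sup_right⟩
        uniq := fun W => Subtype.ext (Submodule.eq_of_le_of_finrank_eq
          (sup_le W.2.2.1 W.2.2.2) (hi.trans W.2.1.symm)).symm }
    have h2 : Unique {S : Submodule F V // finrank F S + 1 = i ∧ S ≤ T.1 ∧ S ≤ T'.1} :=
      { default := ⟨T.1 ⊓ T'.1, by omega, inf_le_left, inf_le_right⟩
        uniq := fun S => Subtype.ext (Submodule.eq_of_le_of_finrank_eq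
          (le_inf S.2.2.1 S.2.2.2)
          (show finrank F S.1 = finrank F (T.1 ⊓ T'.1 : Submodule F V) by
            have := S.2.1; omega)) }
    rw [Nat.card_unique, Nat.card_unique]
  · have h1 : IsEmpty {W : Submodule F V // finrank F W = i + 1 ∧ T.1 ≤ W ∧ T'.1 ≤ W} := by
      refine ⟨fun W => hi ?_⟩
      have := Submodule.finrank_mono (sup_le W.2.2.1 W.2.2.2)
      have := W.2.1
      omega
    have h2 : IsEmpty {S : Submodule F V // finrank F S + 1 = i ∧ S ≤ T.1 ∧ S ≤ T'.1} := by
      refine ⟨fun S => hi ?_⟩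
      have := Submodule.finrank_mono (le_inf S.2.2.1 S.2.2.2)
      have := S.2.1
      omega
    rw [Nat.card_of_isEmpty, Nat.card_of_isEmpty]

omit [∀ i, Fintype (KSubspace F V i)] in
lemma card_upper {i : ℕ} (hi : i ≤ finrank F V) (T : KSubspace F V i) :
    (Nat.card {W : Submodule F V // finrank F W = i + 1 ∧ T.1 ≤ W} : ℝ) =
      gaussianCoeff (Fintype.card F) ((finrank F V - i : ℕ) : ℤ) 1 := by
  have h := card_le_le (le_top : T.1 ≤ ⊤) (r := finrank F V - i)
    (by rw [finrank_top, T.2]; omega) 1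
  simpa [T.2] using h

omit [∀ i, Fintype (KSubspace F V i)] in
/-- The condition `finrank F S + 1 = i` avoids the truncated subtraction `i - 1`: there is no such
`S` for `i = 0`, and `[0 choose 1]_q = 0`. -/
lemma card_lower {i : ℕ} (T : KSubspace F V i) :
    (Nat.card {S : Submodule F V // finrank F S + 1 = i ∧ S ≤ T.1} : ℝ) =
      gaussianCoeff (Fintype.card F) (i : ℤ) 1 := by
  cases i with
  | zero =>
    rw [gaussianCoeff_zero_succ Fintype.one_lt_card]
    simp
  | succ s =>
    rw [gaussianCoeff_symm Fintype.one_lt_card s 1 |>.symm]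
    simpa [T.2] using card_le_subspace T.1 s

/-- Below the middle dimension the inclusion operator from one dimension to the next is
injective: with `U` this operator and `D` the adjoint of the one ending in dimension `i`, the
norms satisfy `‖U f‖² = ‖D f‖² + c ‖f‖²` for a positive constant `c`. -/
lemma inclusionSum_succ_injective {i : ℕ} (hi : 2 * i < finrank F V) :
    Function.Injective (inclusionSum F V i (i + 1)) := by
  have : Finite V := Module.finite_of_finite F
  have : Finite (Submodule F V) :=
    Finite.of_injective (fun W : Submodule F V => (W : Set V)) SetLike.coe_injective
  have : Fintype {S : Submodule F V // finrank F S + 1 = i} := Fintype.ofFinite _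
  set c := gaussianCoeff (Fintype.card F) ((finrank F V - i : ℕ) : ℤ) 1 -
    gaussianCoeff (Fintype.card F) (i : ℤ) 1 with hc
  have hcpos : 0 < c :=
    sub_pos.2 (gaussianCoeff_one_lt Fintype.one_lt_card (by omega))
  have hcount : ∀ T T' : KSubspace F V i,
      (∑ W : KSubspace F V (i + 1), if T.1 ≤ W.1 ∧ T'.1 ≤ W.1 then (1 : ℝ) else 0) =
        (∑ S : {S : Submodule F V // finrank F S + 1 = i},
          if S.1 ≤ T.1 ∧ S.1 ≤ T'.1 then (1 : ℝ) else 0) + if T = T' then c else 0 := by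
    intro T T'
    rw [sum_subtype_ite (fun W : Submodule F V => finrank F W = i + 1)
      (fun W => T.1 ≤ W ∧ T'.1 ≤ W), sum_subtype_ite (fun S : Submodule F V => finrank F S + 1 = i)
      (fun S => S ≤ T.1 ∧ S ≤ T'.1), mul_one, mul_one]
    by_cases h : T = T'
    · subst h
      simp only [and_self, if_true]
      rw [card_upper (by omega), card_lower, hc]
      ring
    · rw [card_upper_eq_card_lower h, if_neg h, add_zero]
  have hnorm : ∀ f : KSubspace F V i → ℝ, ∑ W, (inclusionSum F V i (i + 1) f W) ^ 2 =
      (∑ S : {S : Submodule F V // finrank F S + 1 = i},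
        (∑ T : KSubspace F V i, if S.1 ≤ T.1 then f T else 0) ^ 2) + c * ∑ T, f T ^ 2 := by
    intro f
    simp only [inclusionSum_apply]
    rw [sum_sq_sum_ite (fun (W : KSubspace F V (i + 1)) (T : KSubspace F V i) => T.1 ≤ W.1),
      sum_sq_sum_ite (fun (S : {S : Submodule F V // finrank F S + 1 = i})
        (T : KSubspace F V i) => S.1 ≤ T.1)]
    simp only [hcount, mul_add, Finset.sum_add_distrib, Finset.mul_sum]
    congr 1
    refine Finset.sum_congr rfl fun T _ => ?_
    simp
    ring
  rw [← LinearMap.ker_eq_bot, eq_bot_iff]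
  intro f hf
  rw [LinearMap.mem_ker] at hf
  have h := hnorm f
  simp only [hf, Pi.zero_apply, ne_eq, OfNat.ofNat_ne_zero, not_false_eq_true, zero_pow,
    Finset.sum_const_zero] at h
  have h1 : 0 ≤ ∑ S : {S : Submodule F V // finrank F S + 1 = i},
      (∑ T : KSubspace F V i, if S.1 ≤ T.1 then f T else 0) ^ 2 :=
    Finset.sum_nonneg fun S _ => sq_nonneg _
  have h2 : 0 ≤ ∑ T, f T ^ 2 := Finset.sum_nonneg fun T _ => sq_nonneg _
  have h3 : ∑ T, f T ^ 2 = 0 := by nlinarith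
  refine (Submodule.mem_bot ℝ).2 (funext fun T => ?_)
  exact pow_eq_zero_iff two_ne_zero |>.1
    ((Finset.sum_eq_zero_iff_of_nonneg fun T _ => sq_nonneg (f T)).1 h3 T (Finset.mem_univ T))

lemma inclusionSum_injective {i k : ℕ} (hik : i ≤ k) (hk : 2 * k ≤ finrank F V) :
    Function.Injective (inclusionSum F V i k) := by
  induction hik using Nat.decreasingInduction with
  | self => rw [inclusionSum_self]; exact Function.injective_id
  | of_succ j hj ih =>
    intro f g hfg
    have h := inclusionSum_comp_succ (F := F) (V := V) hj.le
    refine inclusionSum_succ_injective (show 2 * j < finrank F V by omega) (ih ?_)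
    rw [← LinearMap.comp_apply, ← LinearMap.comp_apply, h, LinearMap.smul_apply,
      LinearMap.smul_apply, hfg]

lemma range_inclusionSum_le_succ {j k : ℕ} (hjk : j < k) :
    LinearMap.range (inclusionSum F V j k) ≤ LinearMap.range (inclusionSum F V (j + 1) k) := by
  have h := inclusionSum_comp_succ (F := F) (V := V) hjk.le
  have hc := (gaussianCoeff_pos (q := Fintype.card F) Fintype.one_lt_card
    (show 1 ≤ k - j by omega)).ne'
  rw [← LinearMap.range_smul _ _ hc, ← h]
  exact LinearMap.range_comp_le_range _ _

end Inclusion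

/-! ### The eigenvalues -/

lemma choose_two_add (i m : ℕ) :
    (i + m).choose 2 + (m + 1).choose 2 = i.choose 2 + (i + m) * m := by
  induction m with
  | zero => simp
  | succ m ih =>
    have h1 : (i + (m + 1)).choose 2 = (i + m) + (i + m).choose 2 := by
      rw [← add_assoc, Nat.choose_succ_succ' (i + m) 1, Nat.choose_one_right]
    have h2 : (m + 1 + 1).choose 2 = (m + 1) + (m + 1).choose 2 := by
      rw [Nat.choose_succ_succ' (m + 1) 1, Nat.choose_one_right]
    rw [h1, h2]
    linarith

/-- The eigenvalue in the form in which the proof produces it. -/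
lemma qKneserEigenvalue_eq {q : ℕ} (hq : 1 < q) {v k i : ℕ} (hkv : 2 * k ≤ v) (hi : i ≤ k) :
    qKneserEigenvalue q v k i = (-1) ^ i * (q : ℝ) ^ i.choose 2 *
      ((q : ℝ) ^ (k * (k - i)) * gaussianCoeff q ((v - k - i : ℕ) : ℤ) (k - i)) := by
  obtain ⟨m, rfl⟩ := Nat.exists_eq_add_of_le hi
  have h1 : ((v : ℤ) - ((i + m : ℕ) : ℤ) - (i : ℤ)) = ((m + (v - 2 * (i + m)) : ℕ) : ℤ) := by
    omega
  have h2 : v - (i + m) - i = m + (v - 2 * (i + m)) := by omega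
  rw [qKneserEigenvalue, h1, h2, ← gaussianCoeff_symm hq, Nat.add_sub_cancel_left,
    choose_two_add, pow_add]
  ring

lemma abs_qKneserEigenvalue_lt {q : ℕ} (hq : 1 < q) {v k i j : ℕ} (hkv : 2 * k ≤ v)
    (hij : i < j) (hj : j ≤ k) : |qKneserEigenvalue q v k j| < |qKneserEigenvalue q v k i| := by
  have hq' : (1 : ℝ) < q := by exact_mod_cast hq
  have habs : ∀ l ≤ k, |qKneserEigenvalue q v k l| =
      (q : ℝ) ^ (k.choose 2 + (k - l + 1).choose 2) *
        gaussianCoeff q ((v - k - l : ℕ) : ℤ) (v - 2 * k) := by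
    intro l hl
    have hcast : ((v : ℤ) - (k : ℤ) - (l : ℤ)) = ((v - k - l : ℕ) : ℤ) := by omega
    have hg := gaussianCoeff_pos hq (show v - 2 * k ≤ v - k - l by omega)
    rw [qKneserEigenvalue, hcast, abs_mul, abs_mul, abs_neg_one_pow, one_mul, abs_of_pos hg,
      abs_of_pos (by positivity)]
  rw [habs j hj, habs i (by omega)]
  have hchoose : (k - j + 1).choose 2 < (k - i + 1).choose 2 := by
    obtain ⟨n, hn⟩ : ∃ n, k - i = n + 1 := ⟨k - i - 1, by omega⟩
    have h1 : (n + 1 + 1).choose 2 = (n + 1) + (n + 1).choose 2 := by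
      rw [Nat.choose_succ_succ' (n + 1) 1, Nat.choose_one_right]
    have h2 : (k - j + 1).choose 2 ≤ (n + 1).choose 2 := Nat.choose_le_choose 2 (by omega)
    rw [hn]
    omega
  have hpow := pow_lt_pow_right₀ hq' (Nat.add_lt_add_left hchoose (k.choose 2))
  have hg := gaussianCoeff_pos hq (show v - 2 * k ≤ v - k - j by omega)
  have hmono := gaussianCoeff_mono hq (show v - k - j ≤ v - k - i by omega)
    (show v - 2 * k ≤ v - k - j by omega)
  exact mul_lt_mul hpow hmono hg (by positivity)

lemma qKneserEigenvalue_injOn {q : ℕ} (hq : 1 < q) {v k : ℕ} (hkv : 2 * k ≤ v) :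
    Set.InjOn (qKneserEigenvalue q v k) {j : ℕ | j ≤ k} := by
  intro i hi j hj h
  rcases lt_trichotomy i j with hlt | rfl | hlt
  · exact absurd (congrArg abs h) (abs_qKneserEigenvalue_lt hq hkv hlt hj).ne'
  · rfl
  · exact absurd (congrArg abs h) (abs_qKneserEigenvalue_lt hq hkv hlt hi).ne

section Kneser

open Module
open scoped Classical

variable {F V : Type*} [Field F] [AddCommGroup V] [Module F V]
  [∀ i, Fintype (KSubspace F V i)]

variable (F V) in
/-- The adjacency operator of the `q`-Kneser graph: it sums a function over all `k`-dimensional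
subspaces that meet the given one trivially. -/
noncomputable def kneserOp (k : ℕ) : End ℝ (KSubspace F V k → ℝ) :=
  Matrix.toLin' ((qKneserGraph F V k).adjMatrix ℝ)

lemma kneserOp_apply [FiniteDimensional F V] {k : ℕ} (hk : 1 ≤ k) (f : KSubspace F V k → ℝ)
    (U : KSubspace F V k) :
    kneserOp F V k f U = ∑ W : KSubspace F V k, if Disjoint W.1 U.1 then f W else 0 := by
  rw [kneserOp, Matrix.toLin'_apply, Matrix.mulVec, dotProduct]
  refine Finset.sum_congr rfl fun W _ => ?_
  have hadj : (qKneserGraph F V k).Adj U W ↔ Disjoint W.1 U.1 := by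
    rw [disjoint_iff, inf_comm]
    refine ⟨fun h => h.2, fun h => ⟨?_, h⟩⟩
    rintro rfl
    have := U.2
    rw [inf_idem] at h
    rw [h, finrank_bot] at this
    omega
  simp [SimpleGraph.adjMatrix_apply, hadj]

variable [Fintype F] [FiniteDimensional F V]

/-- Möbius inversion in the subspace lattice: the indicator of `T ∩ U = 0` as a combination of
the numbers of common subspaces of each dimension. -/
lemma sum_mobius_common_subspaces {i : ℕ} (T : KSubspace F V i) (U : Submodule F V) :
    ∑ j ∈ Finset.range (i + 1), (-1) ^ j * (Fintype.card F : ℝ) ^ j.choose 2 *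
        (∑ S : KSubspace F V j, if S.1 ≤ T.1 ∧ S.1 ≤ U then (1 : ℝ) else 0) =
      if Disjoint T.1 U then 1 else 0 := by
  have h : finrank F (T.1 ⊓ U : Submodule F V) ≤ i :=
    (Submodule.finrank_mono inf_le_left).trans T.2.le
  simp only [← le_inf_iff]
  have hcount : ∀ j, (∑ S : KSubspace F V j, if S.1 ≤ T.1 ⊓ U then (1 : ℝ) else 0) =
      gaussianCoeff (Fintype.card F) (finrank F (T.1 ⊓ U : Submodule F V) : ℤ) j := fun j => by
    rw [sum_subtype_ite (fun W : Submodule F V => finrank F W = j) (fun W => W ≤ T.1 ⊓ U), mul_one,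
      card_le_subspace]
  simp only [hcount]
  rw [sum_mobius_gaussianCoeff Fintype.one_lt_card _ _ h]
  simp [disjoint_iff, Submodule.finrank_eq_zero]

/-- The key identity: summing `inclusionSum i k f` over the subspaces disjoint from `U` counts
each `T` disjoint from `U` equally often, and Möbius inversion turns the remaining sum over
those `T` into inclusion operators. -/
lemma kneserOp_inclusionSum {i k : ℕ} (hk : 1 ≤ k) (hi : i ≤ k) (hkv : 2 * k ≤ finrank F V)
    (f : KSubspace F V i → ℝ) :
    kneserOp F V k (inclusionSum F V i k f) =
      ∑ j ∈ Finset.range (i + 1), ((-1) ^ j * (Fintype.card F : ℝ) ^ j.choose 2 *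
        ((Fintype.card F : ℝ) ^ (k * (k - i)) *
          gaussianCoeff (Fintype.card F) ((finrank F V - k - i : ℕ) : ℤ) (k - i))) •
        inclusionSum F V j k (fun S => ∑ T : KSubspace F V i, if S.1 ≤ T.1 then f T else 0) := by
  set c := (Fintype.card F : ℝ) ^ (k * (k - i)) *
    gaussianCoeff (Fintype.card F) ((finrank F V - k - i : ℕ) : ℤ) (k - i)
  funext U
  have h1 : kneserOp F V k (inclusionSum F V i k f) U =
      ∑ T : KSubspace F V i, c * (if Disjoint T.1 U.1 then 1 else 0) * f T := by
    rw [kneserOp_apply hk]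
    have : ∀ W : KSubspace F V k, (if Disjoint W.1 U.1 then inclusionSum F V i k f W else 0) =
        ∑ T : KSubspace F V i, if T.1 ≤ W.1 ∧ Disjoint W.1 U.1 then f T else 0 := by
      intro W
      rw [inclusionSum_apply]
      by_cases h : Disjoint W.1 U.1 <;> simp [h]
    simp only [this]
    rw [Finset.sum_comm]
    refine Finset.sum_congr rfl fun T _ => ?_
    rw [sum_subtype_ite (fun W : Submodule F V => finrank F W = k)
      (fun W => T.1 ≤ W ∧ Disjoint W U.1)]
    by_cases h : Disjoint T.1 U.1
    · have := card_le_disjoint h (r := finrank F V - k - i) (by rw [T.2, U.2]; omega) (k - i)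
      rw [T.2, U.2, Nat.add_sub_cancel' hi] at this
      rw [this, if_pos h, mul_one]
    · have : IsEmpty {W : Submodule F V // finrank F W = k ∧ T.1 ≤ W ∧ Disjoint W U.1} :=
        ⟨fun W => h (W.2.2.2.mono_left W.2.2.1)⟩
      rw [Nat.card_of_isEmpty, if_neg h]
      simp
  rw [h1]
  simp only [← sum_mobius_common_subspaces, Finset.sum_apply, Pi.smul_apply, inclusionSum_apply,
    smul_eq_mul, Finset.mul_sum, Finset.sum_mul]
  rw [Finset.sum_comm]
  refine Finset.sum_congr rfl fun j _ => ?_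
  rw [Finset.sum_comm]
  refine Finset.sum_congr rfl fun S _ => ?_
  by_cases hU : S.1 ≤ U.1
  · rw [if_pos hU, Finset.mul_sum]
    refine Finset.sum_congr rfl fun T _ => ?_
    by_cases hT : S.1 ≤ T.1
    · simp only [hU, hT, and_self, if_true]
      ring
    · simp [hT]
  · simp [hU]

variable (F V) in
/-- The filtration of the functions on `k`-dimensional subspaces by the ranges of the inclusion
operators, shifted by one so that it starts with the zero space: its `(i + 1)`-st member consists
of the functions that come from dimension `i`. -/
noncomputable def inclusionFiltration (k : ℕ) : ℕ → Submodule ℝ (KSubspace F V k → ℝ)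
  | 0 => ⊥
  | i + 1 => LinearMap.range (inclusionSum F V i k)

lemma inclusionFiltration_le_succ {i k : ℕ} (hi : i ≤ k) :
    inclusionFiltration F V k i ≤ inclusionFiltration F V k (i + 1) := by
  cases i with
  | zero => exact bot_le
  | succ j => exact range_inclusionSum_le_succ hi

lemma inclusionFiltration_mono {i j k : ℕ} (hij : i ≤ j) (hj : j ≤ k) :
    inclusionFiltration F V k i ≤ inclusionFiltration F V k j := by
  induction j, hij using Nat.le_induction with
  | base => exact le_rfl
  | succ j hij ih => exact (ih (by omega)).trans (inclusionFiltration_le_succ (by omega))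

lemma finrank_inclusionFiltration_succ {i k : ℕ} (hi : i ≤ k) (hkv : 2 * k ≤ finrank F V) :
    (finrank ℝ (inclusionFiltration F V k (i + 1)) : ℝ) =
      gaussianCoeff (Fintype.card F) (finrank F V : ℤ) i := by
  rw [inclusionFiltration, LinearMap.finrank_range_of_inj (inclusionSum_injective hi hkv),
    finrank_fintype_fun_eq_card, ← Nat.card_eq_fintype_card, card_KSubspace]

/-- Modulo the previous member of the filtration the adjacency operator is a scalar. -/
lemma kneserOp_sub_smul_mem {k : ℕ} (hk : 1 ≤ k) (hkv : 2 * k ≤ finrank F V) :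
    ∀ i ≤ k, ∀ x ∈ inclusionFiltration F V k (i + 1),
      kneserOp F V k x - qKneserEigenvalue (Fintype.card F) (finrank F V) k i • x ∈
        inclusionFiltration F V k i := by
  rintro i hi _ ⟨f, rfl⟩
  have hself : (fun S : KSubspace F V i => ∑ T : KSubspace F V i, if S.1 ≤ T.1 then f T else 0) =
      f := funext (sum_le_same_dim f)
  rw [kneserOp_inclusionSum hk hi hkv, qKneserEigenvalue_eq Fintype.one_lt_card hkv hi,
    Finset.sum_range_succ, hself, add_sub_cancel_right]
  refine Submodule.sum_mem _ fun j hj => Submodule.smul_mem _ _ ?_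
  have hj := Finset.mem_range.1 hj
  exact inclusionFiltration_mono (show j + 1 ≤ i by omega) hi ⟨_, rfl⟩

omit [Fintype F] in
lemma inclusionFiltration_top (k : ℕ) : inclusionFiltration F V k (k + 1) = ⊤ := by
  rw [inclusionFiltration, inclusionSum_self, LinearMap.range_id]

lemma finrank_eigenspace_kneserOp {k : ℕ} (hk : 1 ≤ k) (hkv : 2 * k ≤ finrank F V) {j : ℕ}
    (hj : j ≤ k) :
    (finrank ℝ ((kneserOp F V k).eigenspace
      (qKneserEigenvalue (Fintype.card F) (finrank F V) k j)) : ℝ) =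
        if j = 0 then 1 else gaussianCoeff (Fintype.card F) (finrank F V : ℤ) j -
          gaussianCoeff (Fintype.card F) (finrank F V : ℤ) (j - 1) := by
  have h := finrank_eigenspace_add_finrank (A := kneserOp F V k) (L := inclusionFiltration F V k)
    rfl (inclusionFiltration_top k) (fun i hi => inclusionFiltration_le_succ hi)
    (kneserOp_sub_smul_mem hk hkv) (qKneserEigenvalue_injOn Fintype.one_lt_card hkv) hj
  have h' := congrArg (Nat.cast : ℕ → ℝ) h
  rw [Nat.cast_add, finrank_inclusionFiltration_succ hj hkv] at h'
  cases j with
  | zero =>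
    rw [inclusionFiltration, finrank_bot, gaussianCoeff_zero_right] at h'
    simpa using h'
  | succ i =>
    rw [finrank_inclusionFiltration_succ (by omega) hkv] at h'
    rw [if_neg i.succ_ne_zero, Nat.add_sub_cancel]
    linarith

lemma hasEigenvalue_kneserOp_iff {k : ℕ} (hk : 1 ≤ k) (hkv : 2 * k ≤ finrank F V) {μ : ℝ} :
    (kneserOp F V k).HasEigenvalue μ ↔
      ∃ j ≤ k, qKneserEigenvalue (Fintype.card F) (finrank F V) k j = μ := by
  refine ⟨fun h => exists_eq_of_hasEigenvalue (L := inclusionFiltration F V k) rfl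
    (inclusionFiltration_top k) (kneserOp_sub_smul_mem hk hkv) h, ?_⟩
  rintro ⟨j, hj, rfl⟩ hbot
  have h := finrank_eigenspace_kneserOp (F := F) (V := V) hk hkv hj
  have hbot' : (kneserOp F V k).eigenspace
      (qKneserEigenvalue (Fintype.card F) (finrank F V) k j) = ⊥ := hbot
  rw [hbot', finrank_bot, Nat.cast_zero] at h
  cases j with
  | zero => simp at h
  | succ i =>
    have := gaussianCoeff_lt_succ (q := Fintype.card F) Fintype.one_lt_card
      (show 2 * i + 1 < finrank F V by omega)
    rw [if_neg i.succ_ne_zero, Nat.add_sub_cancel] at h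
    linarith

end Kneser

theorem mainTheorem1 {F V : Type*} [Field F] [Fintype F] [AddCommGroup V] [Module F V]
    [FiniteDimensional F V] (q v k : ℕ) (hq : Fintype.card F = q)
    (hv : Module.finrank F V = v) (hk : 1 ≤ k) (hkv : 2 * k ≤ v)
    [Fintype (KSubspace F V k)] [DecidableEq (KSubspace F V k)]
    [DecidableRel (qKneserGraph F V k).Adj] :
    Set.InjOn (qKneserEigenvalue q v k) {j : ℕ | j ≤ k} ∧
    {μ : ℝ | Module.End.HasEigenvalue
        (Matrix.toLin' ((qKneserGraph F V k).adjMatrix ℝ)) μ} =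
      qKneserEigenvalue q v k '' {j : ℕ | j ≤ k} ∧
    ∀ j : ℕ, j ≤ k →
      (Module.finrank ℝ (Module.End.eigenspace
          (Matrix.toLin' ((qKneserGraph F V k).adjMatrix ℝ)) (qKneserEigenvalue q v k j)) : ℝ) =
        if j = 0 then 1 else gaussianCoeff q (v : ℤ) j - gaussianCoeff q (v : ℤ) (j - 1) := by
  subst hq hv
  rename_i instF instD instR
  -- The instances in the statement agree with the classical ones used above.
  obtain rfl : instF = Fintype.ofFinite _ := Subsingleton.elim _ _
  let inst : ∀ i, Fintype (KSubspace F V i) := fun i => Fintype.ofFinite _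
  have hop : Matrix.toLin' ((qKneserGraph F V k).adjMatrix ℝ) = kneserOp F V k := by
    rw [kneserOp]
    congr!
  refine ⟨qKneserEigenvalue_injOn Fintype.one_lt_card hkv, Set.ext fun μ => ?_, fun j hj => ?_⟩
  · rw [hop]
    exact hasEigenvalue_kneserOp_iff hk hkv
  · rw [hop]
    exact finrank_eigenspace_kneserOp hk hkv hj
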